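/- For all non-negative integers $c$ and $r$ there is a polynomial $f$ with non-negative integer coefficients, depending only on $c$ and $r$, such that the following holds. Let $X$ be a finite set with $|X|\le r$, let $R$ be a finite set of words over $X\cup X^{-1}$, let $L$ be the sum of the lengths of the words in $R$, and suppose that the group $G=\langle X\mid R\rangle$ is nilpotent of class at most $c$. Then the elements of finite order in $G$ form a subgroup $T$ (the torsion subgroup of $G$), $T$ is finite, and $|T|\le f(L)$. -/

import Mathlib

/-- A word over `X ∪ X⁻¹` (not necessarily reduced); the letter `(x, true)` stands for `x` and
`(x, false)` for `x⁻¹`. -/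
abbrev GroupWord (X : Type*) : Type _ := List (X × Bool)

/-- The group `⟨X | R⟩` defined by generators `X` and a finite set `R` of words over `X ∪ X⁻¹`. -/
abbrev FinPresented (X : Type*) (R : Finset (GroupWord X)) : Type _ :=
  PresentedGroup ((fun w : GroupWord X => (FreeGroup.mk w : FreeGroup X)) '' (R : Set (GroupWord X)))

/-- The sum of the lengths of the relators. -/
def relatorLength {X : Type*} (R : Finset (GroupWord X)) : ℕ :=
  ∑ w ∈ R, w.length

/-- `T` is the torsion subgroup of `G`: its elements are exactly the elements of `G` of finite
order. There is at most one such subgroup. -/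
def IsTorsionSubgroup {G : Type*} [Group G] (T : Subgroup G) : Prop :=
  ∀ g : G, g ∈ T ↔ IsOfFinOrder g

open scoped Pointwise commutatorElement

/-! For fixed rank `k` and class bound `c`, every group in question is a quotient of one fixed group
`N`, the free nilpotent group, by the normal closure of a set `S` of elements of length at most `L`.
Refining the lower central series gives `N` a central series `A i` with cyclic factors generated by
`x i`. Its image is such a series in `G`, and `|T|` is at most `M ^ n`, where `n` is the fixed
number of factors and `M` bounds the orders of the finite ones. So it suffices to bound,
polynomially in `L`, the order of `x i` modulo `A (i + 1)` and the normal closure of `S` whenever it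
is finite (`exists_polynomial_pow_mem`).

Two facts give this. First, the `A i` are at most polynomially distorted, so a short element of `A
i` has polynomially bounded exponent of `x i` modulo `A (i + 1)` (`exists_polynomial_exponent`).
Second, Gaussian elimination along the series replaces `S` by polynomially short elements of `A i`,
still in its normal closure, which capture up to powers everything of that closure lying in `A i`
(`exists_polynomial_elimination`). If `x i` has infinite order modulo `A (i + 1)` but finite order
after adding `S`, one of these elements lies outside `A (i + 1)`, and its exponent is the required
bound. All polynomials depend on `N` alone, since the number of steps is fixed. -/

theorem Polynomial.eval_monotone_nat (p : Polynomial ℕ) : Monotone fun n => p.eval n := by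
  intro a b hab
  simp only [Polynomial.eval_eq_sum_range]
  gcongr

/-! ### Word length: `S ^ m` as the set of products of `m` elements of `S` -/

section Balls

variable {N : Type*} [Group N] {S T : Set N} {g h : N} {m n : ℕ}

theorem Set.mul_mem_pow_add (hg : g ∈ S ^ m) (hh : h ∈ S ^ n) : g * h ∈ S ^ (m + n) := by
  rw [pow_add]
  exact Set.mul_mem_mul hg hh

theorem Set.inv_mem_pow (hS : S⁻¹ = S) (hg : g ∈ S ^ m) : g⁻¹ ∈ S ^ m := by
  rw [← hS, inv_pow]
  simpa using hg

theorem Set.zpow_mem_pow_mul (hS : S⁻¹ = S) (hg : g ∈ S ^ m) (e : ℤ) :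
    g ^ e ∈ S ^ (m * e.natAbs) := by
  have h1 : g ^ e.natAbs ∈ S ^ (m * e.natAbs) := by
    rw [pow_mul]
    exact Set.pow_mem_pow hg
  rcases Int.natAbs_eq e with h | h
  · rw [h, zpow_natCast, Int.natAbs_natCast]
    exact h1
  · rw [h, zpow_neg, zpow_natCast, Int.natAbs_neg, Int.natAbs_natCast]
    exact Set.inv_mem_pow hS h1

theorem Set.map_mem_pow {M : Type*} [Group M] {U : Set M} (φ : N →* M) (h : ∀ u ∈ S, φ u ∈ U)
    (hg : g ∈ S ^ m) : φ g ∈ U ^ m := by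
  have h1 : φ g ∈ φ '' (S ^ m) := ⟨g, hg, rfl⟩
  rw [Set.image_pow] at h1
  exact Set.pow_subset_pow_left (Set.image_subset_iff.2 h) h1

theorem Set.pow_subset_pow_mul {a : ℕ} (h : T ⊆ S ^ a) : T ^ m ⊆ S ^ (a * m) := by
  rw [pow_mul]
  exact Set.pow_subset_pow_left h

end Balls

/-! ### Cyclic central series and polynomial distortion -/

/-- A descending sequence of subgroups with `[A i, N] ≤ A (i + 1)` in which `A i` is generated by
`x i` modulo `A (i + 1)`. -/
structure IsCyclicCentralSeries {N : Type*} [Group N] (A : ℕ → Subgroup N) (x : ℕ → N) :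
    Prop where
  succ_le : ∀ i, A (i + 1) ≤ A i
  mem : ∀ i, x i ∈ A i
  commutator_mem : ∀ i, ∀ g ∈ A i, ∀ h, ⁅g, h⁆ ∈ A (i + 1)
  exists_zpow : ∀ i, ∀ g ∈ A i, ∃ e : ℤ, x i ^ (-e) * g ∈ A (i + 1)

/-- The letters `x j` and their inverses for `j ≥ i`, together with `1`. -/
def tailLetters {N : Type*} [Group N] (x : ℕ → N) (i : ℕ) : Set N :=
  {g | g = 1 ∨ ∃ j ≥ i, g = x j ∨ g = (x j)⁻¹}

section TailLetters

variable {N : Type*} [Group N] (x : ℕ → N) (i : ℕ)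

theorem one_mem_tailLetters : (1 : N) ∈ tailLetters x i := Or.inl rfl

theorem self_mem_tailLetters : x i ∈ tailLetters x i := Or.inr ⟨i, le_rfl, Or.inl rfl⟩

theorem inv_tailLetters : (tailLetters x i)⁻¹ = tailLetters x i := by
  ext g
  simp only [tailLetters, Set.mem_inv, Set.mem_ofPred_eq, inv_eq_iff_eq_inv, inv_inv,
    inv_one]
  refine or_congr Iff.rfl (exists_congr fun j => and_congr Iff.rfl or_comm)

theorem tailLetters_succ_subset : tailLetters x (i + 1) ⊆ tailLetters x i := by
  rintro g (h | ⟨j, hj, h⟩)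
  · exact Or.inl h
  · exact Or.inr ⟨j, by omega, h⟩

variable {x i}

theorem mem_tailLetters_cases {g : N} (h : g ∈ tailLetters x i) :
    g ∈ tailLetters x (i + 1) ∨ g = x i ∨ g = (x i)⁻¹ := by
  rcases h with h | ⟨j, hj, h⟩
  · exact Or.inl (Or.inl h)
  · rcases eq_or_lt_of_le hj with rfl | hj
    · exact Or.inr h
    · exact Or.inl (Or.inr ⟨j, hj, h⟩)

end TailLetters

namespace IsCyclicCentralSeries

variable {N : Type*} [Group N] {A : ℕ → Subgroup N} {x : ℕ → N}

theorem antitone (h : IsCyclicCentralSeries A x) : Antitone A := antitone_nat_of_succ_le h.succ_le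

theorem normal (h : IsCyclicCentralSeries A x) (i : ℕ) : (A i).Normal := by
  refine ⟨fun g hg n => ?_⟩
  have h1 := (A i).mul_mem ((A i).inv_mem (h.succ_le i (h.commutator_mem i g hg n))) hg
  have h2 : (⁅g, n⁆)⁻¹ * g = n * g * n⁻¹ := by rw [commutatorElement_def]; group
  rwa [h2] at h1

theorem tailLetters_pow_subset (h : IsCyclicCentralSeries A x) (i m : ℕ) :
    tailLetters x i ^ m ⊆ A i := by
  induction m with
  | zero => simp
  | succ m ih =>
    rw [pow_succ]
    rintro _ ⟨a, ha, b, hb, rfl⟩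
    refine (A i).mul_mem (ih ha) ?_
    rcases hb with rfl | ⟨j, hj, rfl | rfl⟩
    · exact one_mem _
    · exact h.antitone hj (h.mem j)
    · exact inv_mem (h.antitone hj (h.mem j))

theorem exists_mem_tailLetters_pow (h : IsCyclicCentralSeries A x) {n : ℕ} (hn : A n = ⊥) (i : ℕ) :
    ∀ g ∈ A i, ∃ m, g ∈ tailLetters x i ^ m := by
  rcases le_total i n with hi | hi
  · induction hi using Nat.decreasingInduction with
    | self =>
      intro g hg
      rw [hn, Subgroup.mem_bot] at hg
      exact ⟨0, by simp [hg]⟩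
    | of_succ i _ ih =>
      intro g hg
      obtain ⟨e, he⟩ := h.exists_zpow i g hg
      obtain ⟨m, hm⟩ := ih _ he
      have h1 : x i ^ e ∈ tailLetters x i ^ (1 * e.natAbs) :=
        Set.zpow_mem_pow_mul (inv_tailLetters x i) (by simpa using self_mem_tailLetters x i) e
      have h2 := Set.mul_mem_pow_add h1 (Set.pow_subset_pow_left (tailLetters_succ_subset x i) hm)
      exact ⟨_, by simpa using h2⟩
  · intro g hg
    have := h.antitone hi hg
    rw [hn, Subgroup.mem_bot] at this
    exact ⟨0, by simp [this]⟩

/-- Conjugation by the `m`-th power of a fixed element lengthens letters only polynomially. -/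
theorem exists_polynomial_conj (h : IsCyclicCentralSeries A x) {n : ℕ} (hn : A n = ⊥) (y : N)
    (j : ℕ) : ∃ q : Polynomial ℕ, ∀ u ∈ tailLetters x j, ∀ m : ℕ,
      y ^ m * u * (y ^ m)⁻¹ ∈ tailLetters x j ^ q.eval m := by
  rcases le_total j n with hj | hj
  case inr =>
    refine ⟨0, fun u hu m => ?_⟩
    have h1 : u ∈ A j := h.tailLetters_pow_subset j 1 (by simpa using hu)
    have h2 := h.antitone hj h1
    rw [hn, Subgroup.mem_bot] at h2
    simp [h2]
  induction hj using Nat.decreasingInduction with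
  | self =>
    refine ⟨0, fun u hu m => ?_⟩
    have h1 : u ∈ A n := h.tailLetters_pow_subset n 1 (by simpa using hu)
    rw [hn, Subgroup.mem_bot] at h1
    simp [h1]
  | of_succ j _ ih =>
    obtain ⟨q, hq⟩ := ih
    obtain ⟨a, ha⟩ := h.exists_mem_tailLetters_pow hn (j + 1) ⁅(x j)⁻¹, y⁆
      (h.commutator_mem j _ (inv_mem (h.mem j)) y)
    have hsub := tailLetters_succ_subset x j
    have hone := one_mem_tailLetters x j
    -- Raising `m` by one multiplies on the right by the conjugate under `y ^ m` of the fixed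
    -- element `⁅(x j)⁻¹, y⁆`. This is a word of length `a` in later letters, so the induction
    -- hypothesis bounds the conjugate by `q.eval m * a`.
    have key : ∀ m : ℕ, y ^ m * x j * (y ^ m)⁻¹ ∈ tailLetters x j ^ (1 + m * (q.eval m * a)) := by
      intro m
      induction m with
      | zero => simpa using self_mem_tailLetters x j
      | succ m ihm =>
        have h1 : y ^ m * ⁅(x j)⁻¹, y⁆ * (y ^ m)⁻¹ ∈ tailLetters x j ^ (q.eval m * a) := by
          have := Set.map_mem_pow (MulAut.conj (y ^ m)).toMonoidHom
            (U := tailLetters x (j + 1) ^ q.eval m) (fun u hu => hq u hu m) ha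
          rw [← pow_mul] at this
          exact Set.pow_subset_pow_left hsub this
        have h2 := Set.mul_mem_pow_add ihm h1
        have h3 : y ^ m * x j * (y ^ m)⁻¹ * (y ^ m * ⁅(x j)⁻¹, y⁆ * (y ^ m)⁻¹)
            = y ^ (m + 1) * x j * (y ^ (m + 1))⁻¹ := by
          rw [commutatorElement_def, pow_succ]; group
        rw [h3] at h2
        refine Set.pow_subset_pow_right hone ?_ h2
        have hm : q.eval m ≤ q.eval (m + 1) := q.eval_monotone_nat (Nat.le_succ m)
        calc 1 + m * (q.eval m * a) + q.eval m * a = 1 + (m + 1) * (q.eval m * a) := by ring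
          _ ≤ _ := by gcongr
    refine ⟨q + 1 + Polynomial.X * (q * Polynomial.C a), fun u hu m => ?_⟩
    simp only [Polynomial.eval_add, Polynomial.eval_mul, Polynomial.eval_X, Polynomial.eval_C,
      Polynomial.eval_one]
    rcases mem_tailLetters_cases hu with hu | rfl | rfl
    · exact Set.pow_subset_pow hsub hone (by omega) (hq u hu m)
    · exact Set.pow_subset_pow_right hone (by omega) (key m)
    · have h1 := Set.inv_mem_pow (inv_tailLetters x j) (key m)
      have h2 : (y ^ m * x j * (y ^ m)⁻¹)⁻¹ = y ^ m * (x j)⁻¹ * (y ^ m)⁻¹ := by group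
      rw [h2] at h1
      exact Set.pow_subset_pow_right hone (by omega) h1

/-- Collecting the occurrences of `x i` to the left lengthens a word only polynomially. -/
theorem exists_polynomial_collect (h : IsCyclicCentralSeries A x) {n : ℕ} (hn : A n = ⊥) (i : ℕ) :
    ∃ q : Polynomial ℕ, ∀ m, ∀ w ∈ tailLetters x i ^ m, ∃ e : ℤ, e.natAbs ≤ m ∧
      x i ^ (-e) * w ∈ tailLetters x (i + 1) ^ q.eval m := by
  obtain ⟨q₁, hq₁⟩ := h.exists_polynomial_conj hn (x i) (i + 1)
  obtain ⟨q₂, hq₂⟩ := h.exists_polynomial_conj hn (x i)⁻¹ (i + 1)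
  have hone := one_mem_tailLetters x (i + 1)
  have hq : ∀ u ∈ tailLetters x (i + 1), ∀ e : ℤ,
      x i ^ (-e) * u * x i ^ e ∈ tailLetters x (i + 1) ^ (q₁ + q₂).eval e.natAbs := by
    intro u hu e
    rw [Polynomial.eval_add]
    rcases Int.natAbs_eq e with he | he
    · have := hq₂ u hu e.natAbs
      refine Set.pow_subset_pow_right hone (Nat.le_add_left _ _) ?_
      rw [he, zpow_neg, zpow_natCast, Int.natAbs_natCast]
      simpa using this
    · have := hq₁ u hu e.natAbs
      refine Set.pow_subset_pow_right hone (Nat.le_add_right _ _) ?_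
      rw [he, neg_neg, zpow_neg, zpow_natCast, Int.natAbs_neg, Int.natAbs_natCast]
      exact this
  -- Each of the at most `m` later letters is conjugated by a power of `x i` with exponent at most
  -- `m` in absolute value.
  refine ⟨Polynomial.X * (q₁ + q₂), fun m => ?_⟩
  rw [Polynomial.eval_mul, Polynomial.eval_X]
  induction m with
  | zero =>
    intro w hw
    exact ⟨0, le_rfl, by simpa using hw⟩
  | succ m ih =>
    intro w hw
    rw [pow_succ'] at hw
    obtain ⟨u, hu, v, hv, rfl⟩ := hw
    obtain ⟨e, he, hw'⟩ := ih v hv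
    have hmono : ∀ a ≤ m + 1, (q₁ + q₂).eval a ≤ (q₁ + q₂).eval (m + 1) := fun a ha =>
      (q₁ + q₂).eval_monotone_nat ha
    have hle : m * (q₁ + q₂).eval m ≤ (m + 1) * (q₁ + q₂).eval (m + 1) :=
      Nat.mul_le_mul (Nat.le_succ m) (hmono m (Nat.le_succ m))
    rcases mem_tailLetters_cases hu with hu | rfl | rfl
    · refine ⟨e, by omega, ?_⟩
      have h1 := Set.mul_mem_pow_add (hq u hu e) hw'
      have h2 : x i ^ (-e) * u * x i ^ e * (x i ^ (-e) * v) = x i ^ (-e) * (u * v) := by group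
      rw [h2] at h1
      refine Set.pow_subset_pow_right hone ?_ h1
      have h3 := hmono e.natAbs (by omega)
      have h4 := Nat.mul_le_mul_left m (hmono m (Nat.le_succ m))
      calc _ ≤ (q₁ + q₂).eval (m + 1) + m * (q₁ + q₂).eval (m + 1) := Nat.add_le_add h3 h4
        _ = _ := by ring
    · refine ⟨e + 1, by omega, ?_⟩
      have h2 : x i ^ (-(e + 1)) * (x i * v) = x i ^ (-e) * v := by group
      simp only [h2]
      exact Set.pow_subset_pow_right hone hle hw'
    · refine ⟨e - 1, by omega, ?_⟩
      have h2 : x i ^ (-(e - 1)) * ((x i)⁻¹ * v) = x i ^ (-e) * v := by group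
      simp only [h2]
      exact Set.pow_subset_pow_right hone hle hw'

/-- The subgroups of a cyclic central series are at most polynomially distorted. -/
theorem exists_polynomial_distortion (h : IsCyclicCentralSeries A x) {n : ℕ} (hn : A n = ⊥)
    {V : Set N} {a : ℕ} (hV : V ⊆ tailLetters x 0 ^ a) (i : ℕ) :
    ∃ p : Polynomial ℕ, ∀ l, ∀ g ∈ V ^ l, g ∈ A i → g ∈ tailLetters x i ^ p.eval l := by
  induction i with
  | zero =>
    refine ⟨Polynomial.C a * Polynomial.X, fun l g hg _ => ?_⟩
    simpa using Set.pow_subset_pow_mul hV hg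
  | succ i ih =>
    obtain ⟨p, hp⟩ := ih
    obtain ⟨q, hq⟩ := h.exists_polynomial_collect hn i
    have hone := one_mem_tailLetters x (i + 1)
    -- If `x i` has finite order `o` modulo `A (i + 1)`, then `x i ^ o` is a fixed word of some
    -- length `b`, and powers cost linearly. Otherwise only the zeroth power lies in `A (i + 1)`.
    have hpow : ∃ b : ℕ, ∀ e : ℤ, x i ^ e ∈ A (i + 1) →
        x i ^ e ∈ tailLetters x (i + 1) ^ (b * e.natAbs) := by
      by_cases ho : ∃ o : ℕ, 0 < o ∧ x i ^ o ∈ A (i + 1)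
      · have := h.normal (i + 1)
        set o := orderOf (QuotientGroup.mk' (A (i + 1)) (x i)) with ho'
        have hmem : x i ^ o ∈ A (i + 1) := by
          rw [← QuotientGroup.eq_one_iff, QuotientGroup.mk_pow]
          exact pow_orderOf_eq_one _
        obtain ⟨b, hb⟩ := h.exists_mem_tailLetters_pow hn (i + 1) _ hmem
        refine ⟨b, fun e he => ?_⟩
        have hdvd : (o : ℤ) ∣ e := by
          rw [ho', orderOf_dvd_iff_zpow_eq_one, ← map_zpow]
          exact (QuotientGroup.eq_one_iff _).2 he
        obtain ⟨k, rfl⟩ := hdvd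
        have h1 := Set.zpow_mem_pow_mul (inv_tailLetters x (i + 1)) hb k
        rw [zpow_mul, zpow_natCast]
        refine Set.pow_subset_pow_right hone ?_ h1
        obtain ⟨o₁, ho₁, ho₂⟩ := ho
        have hpos : 0 < o := by
          rw [ho', orderOf_pos_iff]
          refine isOfFinOrder_iff_pow_eq_one.2 ⟨o₁, ho₁, ?_⟩
          rw [← map_pow]
          exact (QuotientGroup.eq_one_iff _).2 ho₂
        rw [Int.natAbs_mul, Int.natAbs_natCast]
        exact Nat.mul_le_mul_left _ (Nat.le_mul_of_pos_left _ hpos)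
      · refine ⟨0, fun e he => ?_⟩
        have h0 : e.natAbs = 0 := by
          by_contra h0
          refine ho ⟨e.natAbs, Nat.pos_of_ne_zero h0, ?_⟩
          rcases Int.natAbs_eq e with h1 | h1
          · rwa [← zpow_natCast, ← h1]
          · rw [h1, zpow_neg, zpow_natCast] at he
            exact inv_mem_iff.1 he
        rw [Int.natAbs_eq_zero.1 h0]
        simp
    obtain ⟨b, hb⟩ := hpow
    refine ⟨Polynomial.C b * p + q.comp p, fun l g hg hgA => ?_⟩
    have h1 := hp l g hg (h.succ_le i hgA)
    obtain ⟨e, he, hw⟩ := hq _ g h1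
    have h2 : x i ^ e ∈ A (i + 1) := by
      have h3 := (A (i + 1)).mul_mem hgA (inv_mem (h.tailLetters_pow_subset (i + 1) _ hw))
      simpa using h3
    have h3 := Set.mul_mem_pow_add (hb e h2) hw
    have h4 : x i ^ e * (x i ^ (-e) * g) = g := by group
    rw [h4] at h3
    simp only [Polynomial.eval_add, Polynomial.eval_mul, Polynomial.eval_C, Polynomial.eval_comp]
    exact Set.pow_subset_pow_right hone
      (Nat.add_le_add_right (Nat.mul_le_mul_left b he) _) h3

theorem exists_polynomial_exponent (h : IsCyclicCentralSeries A x) {n : ℕ} (hn : A n = ⊥)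
    {V : Set N} {a : ℕ} (hV : V ⊆ tailLetters x 0 ^ a) (i : ℕ) :
    ∃ p : Polynomial ℕ, ∀ l, ∀ g ∈ V ^ l, g ∈ A i →
      ∃ e : ℤ, e.natAbs ≤ p.eval l ∧ x i ^ (-e) * g ∈ A (i + 1) := by
  obtain ⟨p, hp⟩ := h.exists_polynomial_distortion hn hV i
  obtain ⟨q, hq⟩ := h.exists_polynomial_collect hn i
  refine ⟨p, fun l g hg hgA => ?_⟩
  obtain ⟨e, he, hw⟩ := hq _ g (hp l g hg hgA)
  exact ⟨e, he, h.tailLetters_pow_subset _ _ hw⟩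

end IsCyclicCentralSeries

/-! ### Elements central modulo a normal subgroup -/

section CentralModulo

variable {N : Type*} [Group N] {K : Subgroup N} [K.Normal]

theorem QuotientGroup.mk_mem_center_iff {s : N} :
    (s : N ⧸ K) ∈ Subgroup.center (N ⧸ K) ↔ ∀ n, ⁅s, n⁆ ∈ K := by
  rw [Subgroup.mem_center_iff, QuotientGroup.mk_surjective.forall]
  refine forall_congr' fun n => ?_
  rw [← QuotientGroup.eq_one_iff, ← QuotientGroup.mk'_apply K ⁅s, n⁆, map_commutatorElement,
    commutatorElement_eq_one_iff_mul_comm]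
  exact eq_comm

theorem QuotientGroup.mk_mem_center_of_generators {V : Set N} (hV : Subgroup.closure V = ⊤) {s : N}
    (hs : ∀ v ∈ V, ⁅s, v⁆ ∈ K) : (s : N ⧸ K) ∈ Subgroup.center (N ⧸ K) := by
  have h1 : Subgroup.closure V ≤
      (Subgroup.centralizer {(s : N ⧸ K)}).comap (QuotientGroup.mk' K) := by
    rw [Subgroup.closure_le]
    intro v hv
    have := hs v hv
    rw [← QuotientGroup.eq_one_iff, ← QuotientGroup.mk'_apply K ⁅s, v⁆, map_commutatorElement,
      commutatorElement_eq_one_iff_mul_comm] at this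
    simp only [SetLike.mem_coe, Subgroup.mem_comap, Subgroup.mem_centralizer_singleton_iff]
    exact this.symm
  rw [Subgroup.mem_center_iff, QuotientGroup.mk_surjective.forall]
  intro n
  have := h1 (hV ▸ Subgroup.mem_top n)
  simp only [Subgroup.mem_comap, Subgroup.mem_centralizer_singleton_iff] at this
  exact this

/-- If modulo `K` the elements `s ∈ S` are central and satisfy `s ^ m = y ^ e`, where `e` is the
exponent of `s` in the cyclic group generated by `x` modulo `B`, then the `m`-th powers of the
elements of `B` in the normal closure of `S` lie in `K`. -/
theorem zpow_mem_of_mem_normalClosure {B : Subgroup N} [B.Normal] {x y : N} {m : ℤ} {S : Set N}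
    (hx : ∀ n, ⁅x, n⁆ ∈ B) (hS : ∀ s ∈ S, ∀ n, ⁅s, n⁆ ∈ K)
    (he : ∀ s ∈ S, ∃ e : ℤ, x ^ (-e) * s ∈ B ∧ s ^ m * y ^ (-e) ∈ K)
    (hy : ∀ e : ℤ, x ^ e ∈ B → y ^ e ∈ K) {g : N} (hg : g ∈ Subgroup.normalClosure S)
    (hgB : g ∈ B) : g ^ m ∈ K := by
  have hxc : (x : N ⧸ B) ∈ Subgroup.center (N ⧸ B) := QuotientGroup.mk_mem_center_iff.2 hx
  -- Centrality modulo `K` makes the `m`-th power multiplicative, so `P` is a subgroup. It is normal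
  -- because its members are central modulo both `K` and `B`.
  let P : Subgroup N :=
    { carrier := {g | (g : N ⧸ K) ∈ Subgroup.center (N ⧸ K) ∧
        ∃ e : ℤ, (g : N ⧸ B) = (x : N ⧸ B) ^ e ∧ (g : N ⧸ K) ^ m = (y : N ⧸ K) ^ e}
      one_mem' := ⟨one_mem _, 0, by simp, by simp⟩
      mul_mem' := by
        rintro a b ⟨ha, e, ha₁, ha₂⟩ ⟨hb, f, hb₁, hb₂⟩
        refine ⟨mul_mem ha hb, e + f, ?_, ?_⟩
        · rw [QuotientGroup.mk_mul, ha₁, hb₁, zpow_add]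
        · rw [QuotientGroup.mk_mul, zpow_add, ← ha₂, ← hb₂]
          exact Commute.mul_zpow (Subgroup.mem_center_iff.1 hb _) m
      inv_mem' := by
        rintro a ⟨ha, e, ha₁, ha₂⟩
        refine ⟨inv_mem ha, -e, ?_, ?_⟩
        · rw [QuotientGroup.mk_inv, ha₁, zpow_neg]
        · rw [QuotientGroup.mk_inv, inv_zpow, ha₂, zpow_neg] }
  have hconj : ∀ {Q : Type _} [Group Q] {a n : Q}, a ∈ Subgroup.center Q → n * a * n⁻¹ = a := by
    intro Q _ a n ha
    rw [Subgroup.mem_center_iff.1 ha n, mul_inv_cancel_right]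
  have hP : P.Normal := by
    refine ⟨?_⟩
    rintro a ⟨ha, e, ha₁, ha₂⟩ n
    have h1 : ((n * a * n⁻¹ : N) : N ⧸ K) = a := by
      rw [QuotientGroup.mk_mul, QuotientGroup.mk_mul, QuotientGroup.mk_inv, hconj ha]
    have h2 : ((n * a * n⁻¹ : N) : N ⧸ B) = a := by
      rw [QuotientGroup.mk_mul, QuotientGroup.mk_mul, QuotientGroup.mk_inv, hconj]
      rw [ha₁]
      exact zpow_mem hxc e
    exact ⟨h1 ▸ ha, e, h2 ▸ ha₁, h1 ▸ ha₂⟩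
  have hSP : S ⊆ P := by
    intro s hs
    obtain ⟨e, h1, h2⟩ := he s hs
    refine ⟨QuotientGroup.mk_mem_center_iff.2 (hS s hs), e, ?_, ?_⟩
    · rw [← QuotientGroup.eq_one_iff, QuotientGroup.mk_mul, QuotientGroup.mk_zpow, zpow_neg] at h1
      exact (inv_mul_eq_one.1 h1).symm
    · rw [← QuotientGroup.eq_one_iff, QuotientGroup.mk_mul, QuotientGroup.mk_zpow,
        QuotientGroup.mk_zpow, zpow_neg] at h2
      exact mul_inv_eq_one.1 h2
  obtain ⟨-, e, h1, h2⟩ := Subgroup.normalClosure_le_normal hSP hg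
  rw [(QuotientGroup.eq_one_iff g).2 hgB, ← QuotientGroup.mk_zpow, eq_comm,
    QuotientGroup.eq_one_iff] at h1
  have h3 := hy e h1
  rw [← QuotientGroup.eq_one_iff, QuotientGroup.mk_zpow] at h3 ⊢
  rw [h2, h3]

end CentralModulo

theorem Subgroup.natAbs_pow_mem_iff {N : Type*} [Group N] {B : Subgroup N} {x : N} (e : ℤ) :
    x ^ e.natAbs ∈ B ↔ x ^ e ∈ B := by
  rcases Int.natAbs_eq e with h1 | h1
  · rw [← zpow_natCast, ← h1]
  · conv_rhs => rw [h1, zpow_neg, zpow_natCast, inv_mem_iff]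

/-! ### Elimination along the series -/

namespace IsCyclicCentralSeries

variable {N : Type*} [Group N] {A : ℕ → Subgroup N} {x : ℕ → N}

/-- A set of short elements of `A i` can be replaced by a set of short elements of `A (i + 1)`
whose normal closure contains a power of each element of `A (i + 1)` in the old normal closure. -/
theorem exists_polynomial_elimination_step (h : IsCyclicCentralSeries A x) {n : ℕ} (hn : A n = ⊥)
    {V : Set N} {a : ℕ} (hV : V ⊆ tailLetters x 0 ^ a) (hV₁ : 1 ∈ V) (hVinv : V⁻¹ = V)
    (hVgen : Subgroup.closure V = ⊤) (i : ℕ) :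
    ∃ t : Polynomial ℕ, ∀ l, ∀ S ⊆ V ^ l, S ⊆ A i → ∃ S' ⊆ V ^ t.eval l,
      S' ⊆ Subgroup.normalClosure S ∧ S' ⊆ A (i + 1) ∧
      ∀ g ∈ Subgroup.normalClosure S, g ∈ A (i + 1) →
        ∃ k : ℕ, 0 < k ∧ g ^ k ∈ Subgroup.normalClosure S' := by
  obtain ⟨p, hp⟩ := h.exists_polynomial_exponent hn hV i
  have hB := h.normal (i + 1)
  have hmk : ∀ {s : N} {e : ℤ}, x i ^ (-e) * s ∈ A (i + 1) →
      (s : N ⧸ A (i + 1)) = (x i : N ⧸ A (i + 1)) ^ e := by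
    intro s e hs
    rw [← QuotientGroup.eq_one_iff, QuotientGroup.mk_mul, QuotientGroup.mk_zpow, zpow_neg] at hs
    exact (inv_mul_eq_one.1 hs).symm
  obtain ⟨o, ho⟩ : ∃ o : ℕ, (0 < o ∧ x i ^ o ∈ A (i + 1)) ∨
      ∀ e : ℤ, x i ^ e ∈ A (i + 1) → e = 0 := by
    by_cases ho : ∃ o : ℕ, 0 < o ∧ x i ^ o ∈ A (i + 1)
    · exact ho.imp fun o ho => Or.inl ho
    · refine ⟨0, Or.inr fun e he => ?_⟩
      by_contra h0
      exact ho ⟨e.natAbs, Int.natAbs_pos.2 h0, (Subgroup.natAbs_pow_mem_iff e).2 he⟩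
  -- The products `s ^ m * y ^ (-e)` cost at most `l * (p + o) + l * p`, the commutators `⁅s, v⁆`
  -- cost `2 * l + 2`.
  refine ⟨.X * (p + .C o) + .X * p + .C 2 * .X + .C 2, fun l S hS hSA => ?_⟩
  simp only [Polynomial.eval_add, Polynomial.eval_mul, Polynomial.eval_X, Polynomial.eval_C]
  by_cases hcase : S ⊆ A (i + 1)
  · refine ⟨S, fun s hs => Set.pow_subset_pow_right hV₁ (by omega) (hS hs),
      Subgroup.subset_normalClosure, hcase, fun g hg _ => ⟨1, one_pos, by simpa using hg⟩⟩
  -- If `x i` has finite order `o` modulo `A (i + 1)`, raising to the power `m = o` kills all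
  -- exponents and `y = 1` will do. Otherwise the pivot `y` is any element of `S` outside `A (i +
  -- 1)`, and `m` is its nonzero exponent.
  have hpivot : ∃ m : ℤ, ∃ y : N, m ≠ 0 ∧ m.natAbs ≤ p.eval l + o ∧ y ∈ V ^ l ∧
      y ∈ Subgroup.normalClosure S ∧ (∀ e : ℤ, x i ^ e ∈ A (i + 1) → y ^ e = 1) ∧
      ∀ (s : N) (e : ℤ), x i ^ (-e) * s ∈ A (i + 1) → s ^ m * y ^ (-e) ∈ A (i + 1) := by
    rcases ho with ⟨ho₁, ho₂⟩ | ho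
    · refine ⟨o, 1, by omega, by simp, Set.one_mem_pow hV₁, one_mem _, by simp, ?_⟩
      intro s e hs
      rw [one_zpow, mul_one, ← QuotientGroup.eq_one_iff, QuotientGroup.mk_zpow, hmk hs,
        ← zpow_mul, mul_comm, zpow_mul, zpow_natCast, ← QuotientGroup.mk_pow,
        (QuotientGroup.eq_one_iff _).2 ho₂, one_zpow]
    · obtain ⟨y, hyS, hyA⟩ := Set.not_subset.1 hcase
      obtain ⟨m, hm₁, hm₂⟩ := hp l y (hS hyS) (hSA hyS)
      refine ⟨m, y, ?_, by omega, hS hyS, Subgroup.subset_normalClosure hyS, ?_, ?_⟩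
      · rintro rfl
        exact hyA (by simpa using hm₂)
      · intro e he
        simp [ho e he]
      · intro s e hs
        rw [← QuotientGroup.eq_one_iff, QuotientGroup.mk_mul, QuotientGroup.mk_zpow,
          QuotientGroup.mk_zpow, hmk hs, hmk hm₂, ← zpow_mul, ← zpow_mul, ← zpow_add]
        rw [show e * m + m * -e = 0 by ring, zpow_zero]
  obtain ⟨m, y, hm₀, hm, hyV, hyS, hy, hmem⟩ := hpivot
  -- The commutators make `S` central modulo the normal closure of `S'`. The other elements are the
  -- row operations cancelling the exponent `e` of `s` against the exponent `m` of the pivot.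
  let S' : Set N := {w | ∃ s ∈ S, (∃ v ∈ V, w = ⁅s, v⁆) ∨
    ∃ e : ℤ, e.natAbs ≤ p.eval l ∧ x i ^ (-e) * s ∈ A (i + 1) ∧ w = s ^ m * y ^ (-e)}
  have hcomm : ∀ s ∈ S, ∀ g, ⁅s, g⁆ ∈ Subgroup.normalClosure S' := by
    intro s hs
    rw [← QuotientGroup.mk_mem_center_iff]
    exact QuotientGroup.mk_mem_center_of_generators hVgen fun v hv =>
      Subgroup.subset_normalClosure ⟨s, hs, Or.inl ⟨v, hv, rfl⟩⟩
  refine ⟨S', ?_, ?_, ?_, ?_⟩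
  · rintro w ⟨s, hs, ⟨v, hv, rfl⟩ | ⟨e, he, -, rfl⟩⟩
    · have hv' : v ∈ V ^ 1 := by simpa using hv
      have h1 := Set.mul_mem_pow_add (Set.mul_mem_pow_add (Set.mul_mem_pow_add (hS hs) hv')
        (Set.inv_mem_pow hVinv (hS hs))) (Set.inv_mem_pow hVinv hv')
      exact Set.pow_subset_pow_right hV₁ (by omega) h1
    · have h1 := Set.mul_mem_pow_add (Set.zpow_mem_pow_mul hVinv (hS hs) m)
        (Set.zpow_mem_pow_mul hVinv hyV (-e))
      rw [Int.natAbs_neg] at h1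
      refine Set.pow_subset_pow_right hV₁ ?_ h1
      have h2 := Nat.mul_le_mul_left l hm
      have h3 := Nat.mul_le_mul_left l he
      omega
  · rintro w ⟨s, hs, ⟨v, hv, rfl⟩ | ⟨e, he, -, rfl⟩⟩
    · have hs' : s ∈ Subgroup.normalClosure S := Subgroup.subset_normalClosure hs
      rw [SetLike.mem_coe, commutatorElement_def, mul_assoc, mul_assoc, ← mul_assoc v]
      exact mul_mem hs' (Subgroup.normalClosure_normal.conj_mem _ (inv_mem hs') v)
    · exact mul_mem (zpow_mem (Subgroup.subset_normalClosure hs) _) (zpow_mem hyS _)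
  · rintro w ⟨s, hs, ⟨v, hv, rfl⟩ | ⟨e, he, hse, rfl⟩⟩
    · exact h.commutator_mem i s (hSA hs) v
    · exact hmem s e hse
  · intro g hg hgA
    refine ⟨m.natAbs, Int.natAbs_pos.2 hm₀, (Subgroup.natAbs_pow_mem_iff m).2 ?_⟩
    refine zpow_mem_of_mem_normalClosure (y := y) (h.commutator_mem i _ (h.mem i)) hcomm
      (fun s hs => ?_) (fun e he => ?_) hg hgA
    · obtain ⟨e, he₁, he₂⟩ := hp l s (hS hs) (hSA hs)
      exact ⟨e, he₂, Subgroup.subset_normalClosure ⟨s, hs, Or.inr ⟨e, he₁, he₂, rfl⟩⟩⟩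
    · rw [hy e he]
      exact one_mem _

theorem exists_polynomial_elimination (h : IsCyclicCentralSeries A x) {n : ℕ} (hn : A n = ⊥)
    (h₀ : A 0 = ⊤) {V : Set N} {a : ℕ} (hV : V ⊆ tailLetters x 0 ^ a) (hV₁ : 1 ∈ V)
    (hVinv : V⁻¹ = V) (hVgen : Subgroup.closure V = ⊤) (i : ℕ) :
    ∃ q : Polynomial ℕ, ∀ l, ∀ S ⊆ V ^ l, ∃ S' ⊆ V ^ q.eval l,
      S' ⊆ Subgroup.normalClosure S ∧ S' ⊆ A i ∧
      ∀ g ∈ Subgroup.normalClosure S, g ∈ A i →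
        ∃ k : ℕ, 0 < k ∧ g ^ k ∈ Subgroup.normalClosure S' := by
  induction i with
  | zero =>
    refine ⟨.X, fun l S hS => ⟨S, by simpa using hS, Subgroup.subset_normalClosure, by simp [h₀],
      fun g hg _ => ⟨1, one_pos, by simpa using hg⟩⟩⟩
  | succ i ih =>
    obtain ⟨q, hq⟩ := ih
    obtain ⟨t, ht⟩ := h.exists_polynomial_elimination_step hn hV hV₁ hVinv hVgen i
    refine ⟨t.comp q, fun l S hS => ?_⟩
    obtain ⟨S₁, h₁V, h₁S, h₁A, h₁⟩ := hq l S hS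
    obtain ⟨S₂, h₂V, h₂S, h₂A, h₂⟩ := ht _ S₁ h₁V h₁A
    refine ⟨S₂, by rwa [Polynomial.eval_comp],
      h₂S.trans (Subgroup.normalClosure_le_normal h₁S), h₂A, fun g hg hgA => ?_⟩
    obtain ⟨k, hk, hgk⟩ := h₁ g hg (h.succ_le i hgA)
    obtain ⟨k', hk', hgk'⟩ := h₂ _ hgk (pow_mem hgA k)
    exact ⟨k * k', Nat.mul_pos hk hk', by rwa [pow_mul]⟩

/-- If `x i` has finite order modulo `A (i + 1)` and the normal closure of a set of elements of
length at most `l`, then this order is at most polynomial in `l`. -/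
theorem exists_polynomial_pow_mem (h : IsCyclicCentralSeries A x) {n : ℕ} (hn : A n = ⊥)
    (h₀ : A 0 = ⊤) {V : Set N} {a : ℕ} (hV : V ⊆ tailLetters x 0 ^ a) (hV₁ : 1 ∈ V)
    (hVinv : V⁻¹ = V) (hVgen : Subgroup.closure V = ⊤) (i : ℕ) :
    ∃ P : Polynomial ℕ, ∀ l, ∀ S ⊆ V ^ l,
      (∃ e : ℕ, 0 < e ∧ x i ^ e ∈ A (i + 1) ⊔ Subgroup.normalClosure S) →
      ∃ e : ℕ, 0 < e ∧ e ≤ P.eval l ∧ x i ^ e ∈ A (i + 1) ⊔ Subgroup.normalClosure S := by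
  have hB := h.normal (i + 1)
  by_cases ho : ∃ o : ℕ, 0 < o ∧ x i ^ o ∈ A (i + 1)
  · obtain ⟨o, ho₁, ho₂⟩ := ho
    exact ⟨.C o, fun l S _ _ => ⟨o, ho₁, by simp, Subgroup.mem_sup_left ho₂⟩⟩
  obtain ⟨p, hp⟩ := h.exists_polynomial_exponent hn hV i
  obtain ⟨q, hq⟩ := h.exists_polynomial_elimination hn h₀ hV hV₁ hVinv hVgen i
  refine ⟨p.comp q, fun l S hS => ?_⟩
  rintro ⟨e, he, hxe⟩
  obtain ⟨S', hS'V, hS'S, hS'A, hS'⟩ := hq l S hS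
  -- Write `x i ^ e = b * g` with `b` in `A (i + 1)` and `g` in the normal closure of `S`. If `S'`
  -- lay in `A (i + 1)`, so would a power of `g`, and `x i` would have finite order modulo `A (i +
  -- 1)`.
  have hnot : ¬ S' ⊆ A (i + 1) := by
    intro hsub
    obtain ⟨b, hb, g, hg, hbg⟩ := Subgroup.mem_sup_of_normal_left.1 hxe
    have hgA : g ∈ A i := by
      have h1 : g = b⁻¹ * x i ^ e := by rw [← hbg]; group
      rw [h1]
      exact mul_mem (inv_mem (h.succ_le i hb)) (pow_mem (h.mem i) e)
    obtain ⟨k, hk, hgk⟩ := hS' g hg hgA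
    have h1 := Subgroup.normalClosure_le_normal hsub hgk
    refine ho ⟨e * k, Nat.mul_pos he hk, ?_⟩
    have h2 : (x i : N ⧸ A (i + 1)) ^ e = g := by
      rw [← QuotientGroup.mk_pow, ← hbg, QuotientGroup.mk_mul, (QuotientGroup.eq_one_iff b).2 hb,
        one_mul]
    rw [← QuotientGroup.eq_one_iff, QuotientGroup.mk_pow, pow_mul, h2, ← QuotientGroup.mk_pow,
      QuotientGroup.eq_one_iff]
    exact h1
  obtain ⟨s, hs, hsA⟩ := Set.not_subset.1 hnot
  obtain ⟨f, hf, hsf⟩ := hp _ s (hS'V hs) (hS'A hs)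
  refine ⟨f.natAbs, ?_, by rwa [Polynomial.eval_comp], ?_⟩
  · rw [Int.natAbs_pos]
    rintro rfl
    exact hsA (by simpa using hsf)
  · rw [Subgroup.natAbs_pow_mem_iff]
    have h1 : x i ^ f = s * (x i ^ (-f) * s)⁻¹ := by group
    rw [h1]
    exact mul_mem (Subgroup.mem_sup_right (hS'S hs)) (inv_mem (Subgroup.mem_sup_left hsf))

end IsCyclicCentralSeries

theorem commutatorElement_pow_left_of_mem_center {G : Type*} [Group G] {g v : G}
    (h : ⁅g, v⁆ ∈ Subgroup.center G) (k : ℕ) : ⁅g ^ k, v⁆ = ⁅g, v⁆ ^ k := by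
  have h1 : v * g * v⁻¹ = (⁅g, v⁆)⁻¹ * g := by rw [commutatorElement_def]; group
  have h2 : v * g ^ k * v⁻¹ = (⁅g, v⁆ ^ k)⁻¹ * g ^ k := by
    rw [← conj_pow, h1, Commute.mul_pow, inv_pow]
    exact (Subgroup.mem_center_iff.1 (inv_mem h) g).symm
  calc ⁅g ^ k, v⁆ = g ^ k * (v * g ^ k * v⁻¹)⁻¹ := by rw [commutatorElement_def]; group
    _ = ⁅g, v⁆ ^ k := by rw [h2]; group

/-! ### The torsion subgroup of a nilpotent group and its order -/

section Torsion

variable {G : Type*} [Group G]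

/-- Modulo `⁅C, ⊤⁆` the subgroup `C` is central, so its exponent can be tested on normal generators.
Taking `B = ⊤` and `x = y = 1` makes the exponent conditions trivial. -/
theorem pow_mem_commutator_of_generators {C : Subgroup G} [C.Normal] {S : Set G} {o : ℕ}
    (hC : C = Subgroup.normalClosure S) (hS : ∀ s ∈ S, s ^ o ∈ ⁅C, (⊤ : Subgroup G)⁆) {g : G}
    (hg : g ∈ C) : g ^ o ∈ ⁅C, (⊤ : Subgroup G)⁆ := by
  have hSC : S ⊆ C := hC ▸ Subgroup.subset_normalClosure
  rw [← zpow_natCast]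
  refine zpow_mem_of_mem_normalClosure (B := ⊤) (x := 1) (y := 1) (by simp)
    (fun s hs n => Subgroup.commutator_mem_commutator (hSC hs) (Subgroup.mem_top n))
    (fun s hs => ⟨0, by simp, by simpa using hS s hs⟩) (by simp) (hC ▸ hg) (Subgroup.mem_top g)

/-- In a nilpotent group the normal closure of an element of finite order is a torsion group. -/
theorem IsOfFinOrder.of_mem_normalClosure [Group.IsNilpotent G] {a g : G} (ha : IsOfFinOrder a)
    (hg : g ∈ Subgroup.normalClosure {a}) : IsOfFinOrder g := by
  obtain ⟨n, hn⟩ := Subgroup.nilpotent_iff_lowerCentralSeries.1 ‹Group.IsNilpotent G›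
  obtain ⟨C, hC₀, hC⟩ : ∃ C : ℕ → Subgroup G, C 0 = Subgroup.normalClosure {a} ∧
      ∀ i, C (i + 1) = ⁅C i, (⊤ : Subgroup G)⁆ :=
    ⟨fun i => Nat.rec (Subgroup.normalClosure {a}) (fun _ D => ⁅D, (⊤ : Subgroup G)⁆) i, rfl,
      fun _ => rfl⟩
  have hnormal : ∀ i, (C i).Normal := by
    intro i
    induction i with
    | zero => exact hC₀ ▸ Subgroup.normalClosure_normal
    | succ i ih => exact hC i ▸ Subgroup.commutator_normal (C i) ⊤
  have hcomm : ∀ i, ∀ g ∈ C i, ∀ v, ⁅g, v⁆ ∈ C (i + 1) := fun i g hg v =>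
    hC i ▸ Subgroup.commutator_mem_commutator hg (Subgroup.mem_top v)
  have hle : ∀ i, C i ≤ (⊤ : Subgroup G).lowerCentralSeries i := by
    intro i
    induction i with
    | zero => exact le_top
    | succ i ih => exact hC i ▸ Subgroup.commutator_mono ih le_rfl
  -- Each factor of `C` is killed by the order of `a`: modulo `C (i + 2)` the commutator `⁅b, v⁆` is
  -- central, so its power equals `⁅b ^ orderOf a, v⁆`, which is trivial there by induction.
  have hpow : ∀ i, ∀ g ∈ C i, g ^ orderOf a ∈ C (i + 1) := by
    intro i
    induction i with
    | zero =>
      intro g hg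
      rw [hC]
      exact pow_mem_commutator_of_generators (S := {a}) hC₀ (by simp [pow_orderOf_eq_one]) hg
    | succ i ih =>
      intro g hg
      have hgen := Subgroup.commutator_def' (C i) ⊤
      rw [← hC] at hgen
      rw [hC]
      refine pow_mem_commutator_of_generators hgen ?_ hg
      rintro _ ⟨b, hb, v, -, rfl⟩
      have hbo := hcomm (i + 1) _ (ih b hb) v
      have hc : ((⁅b, v⁆ : G) : G ⧸ C (i + 2)) ∈ Subgroup.center (G ⧸ C (i + 2)) :=
        QuotientGroup.mk_mem_center_iff.2 (hcomm (i + 1) _ (hcomm i b hb v))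
      rw [← hC]
      rw [← QuotientGroup.eq_one_iff] at hbo ⊢
      rw [← QuotientGroup.mk'_apply, map_commutatorElement] at hbo hc
      rw [← QuotientGroup.mk'_apply, map_pow, map_commutatorElement,
        ← commutatorElement_pow_left_of_mem_center hc, ← map_pow]
      exact hbo
  have hiter : ∀ i, g ^ orderOf a ^ i ∈ C i := by
    intro i
    induction i with
    | zero =>
      rwa [pow_zero, pow_one, hC₀]
    | succ i ih =>
      rw [pow_succ, pow_mul]
      exact hpow i _ ih
  refine isOfFinOrder_iff_pow_eq_one.2 ⟨orderOf a ^ n, pow_pos ha.orderOf_pos n, ?_⟩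
  have := hle n (hiter n)
  rwa [hn, Subgroup.mem_bot] at this

/-- Modulo the normal closure of `a` the product becomes `b`, so its `orderOf b`-th power falls into
that closure, a torsion group. -/
theorem IsOfFinOrder.mul_of_isNilpotent [Group.IsNilpotent G] {a b : G} (ha : IsOfFinOrder a)
    (hb : IsOfFinOrder b) : IsOfFinOrder (a * b) := by
  have h1 : (a * b) ^ orderOf b ∈ Subgroup.normalClosure {a} := by
    have h2 : ((a : G) : G ⧸ Subgroup.normalClosure {a}) = 1 :=
      (QuotientGroup.eq_one_iff a).2 (Subgroup.subset_normalClosure rfl)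
    rw [← QuotientGroup.eq_one_iff, QuotientGroup.mk_pow, QuotientGroup.mk_mul, h2, one_mul,
      ← QuotientGroup.mk_pow, pow_orderOf_eq_one, QuotientGroup.mk_one]
  exact (ha.of_mem_normalClosure h1).of_pow hb.orderOf_pos.ne'

theorem exists_isTorsionSubgroup [Group.IsNilpotent G] : ∃ T : Subgroup G, IsTorsionSubgroup T :=
  ⟨{ carrier := {g | IsOfFinOrder g}
     one_mem' := IsOfFinOrder.one
     mul_mem' := fun ha hb => IsOfFinOrder.mul_of_isNilpotent ha hb
     inv_mem' := fun ha => IsOfFinOrder.inv ha }, fun _ => Iff.rfl⟩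

namespace IsCyclicCentralSeries

variable {B : ℕ → Subgroup G} {y : ℕ → G}

/-- If the finite factors of a cyclic central series have order at most `M`, then passing from
`B (i + 1)` to `B i` multiplies the order of the torsion subgroup by at most `M`. -/
theorem finite_torsion_inf_step (h : IsCyclicCentralSeries B y) {T : Subgroup G}
    (hT : IsTorsionSubgroup T) {M : ℕ} (hM : 0 < M) {i : ℕ}
    (hy : (∃ e : ℕ, 0 < e ∧ y i ^ e ∈ B (i + 1)) →
      ∃ e : ℕ, 0 < e ∧ e ≤ M ∧ y i ^ e ∈ B (i + 1))
    (hfin : Finite ↥(T ⊓ B (i + 1))) :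
    Finite ↥(T ⊓ B i) ∧ Nat.card ↥(T ⊓ B i) ≤ M * Nat.card ↥(T ⊓ B (i + 1)) := by
  have hN := h.normal (i + 1)
  have hmk : ∀ g ∈ B i, ∃ e : ℤ, (g : G ⧸ B (i + 1)) = (y i : G ⧸ B (i + 1)) ^ e := by
    intro g hg
    obtain ⟨e, he⟩ := h.exists_zpow i g hg
    refine ⟨e, ?_⟩
    rw [← QuotientGroup.eq_one_iff, QuotientGroup.mk_mul, QuotientGroup.mk_zpow, zpow_neg] at he
    exact (inv_mul_eq_one.1 he).symm
  by_cases ho : ∃ e : ℕ, 0 < e ∧ y i ^ e ∈ B (i + 1)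
  · obtain ⟨o, ho₀, hoM, hoB⟩ := hy ho
    have hpow : (y i : G ⧸ B (i + 1)) ^ (o : ℤ) = 1 := by
      rw [zpow_natCast, ← QuotientGroup.mk_pow]
      exact (QuotientGroup.eq_one_iff _).2 hoB
    have hex : ∀ g : ↥(T ⊓ B i), ∃ k : Fin M,
        ((g : G) : G ⧸ B (i + 1)) = (y i : G ⧸ B (i + 1)) ^ (k : ℕ) := by
      rintro ⟨g, hg⟩
      obtain ⟨e, he⟩ := hmk g hg.2
      have h1 := Int.emod_nonneg e (b := (o : ℤ)) (by omega)
      have h2 := Int.emod_lt_of_pos e (b := (o : ℤ)) (by omega)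
      refine ⟨⟨(e % o).toNat, by omega⟩, ?_⟩
      change (g : G ⧸ B (i + 1)) = (y i : G ⧸ B (i + 1)) ^ (e % o).toNat
      rw [← zpow_natCast, Int.toNat_of_nonneg h1, he]
      conv_lhs => rw [← Int.emod_add_mul_ediv e o, zpow_add, zpow_mul, hpow, one_zpow, mul_one]
    choose k hk using hex
    classical
    let rep : Fin M → G := fun j =>
      if hj : ∃ g, k g = j then ((Classical.choose hj : ↥(T ⊓ B i)) : G) else 1
    have hrep : ∀ g, rep (k g) ∈ T ⊓ B i ∧
        ((rep (k g) : G) : G ⧸ B (i + 1)) = ((g : G) : G ⧸ B (i + 1)) := by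
      intro g
      have hj : ∃ g', k g' = k g := ⟨g, rfl⟩
      have h1 : rep (k g) = ((Classical.choose hj : ↥(T ⊓ B i)) : G) := dif_pos hj
      rw [h1]
      refine ⟨(Classical.choose hj).2, ?_⟩
      rw [hk, hk g, Classical.choose_spec hj]
    -- Representatives are chosen inside `T`, so dividing by them stays in `T` and lands in `T ⊓ B
    -- (i + 1)`.
    let φ : ↥(T ⊓ B i) → Fin M × ↥(T ⊓ B (i + 1)) := fun g =>
      (k g, ⟨(rep (k g))⁻¹ * g, T.mul_mem (T.inv_mem (hrep g).1.1) g.2.1,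
        QuotientGroup.eq.1 (hrep g).2⟩)
    have hφ : Function.Injective φ := by
      intro g g' hgg
      have h1 : k g = k g' := congrArg Prod.fst hgg
      have h2 : (rep (k g))⁻¹ * (g : G) = (rep (k g'))⁻¹ * (g' : G) :=
        congrArg (fun z => (z.2 : G)) hgg
      rw [h1] at h2
      exact Subtype.ext (mul_left_cancel h2)
    refine ⟨Finite.of_injective φ hφ, ?_⟩
    simpa [Nat.card_prod] using Nat.card_le_card_of_injective φ hφ
  -- With an infinite factor, a torsion element of `B i` has exponent zero and already lies in `B (i
  -- + 1)`.
  · have heq : T ⊓ B i = T ⊓ B (i + 1) := by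
      refine le_antisymm (fun g hg => ⟨hg.1, ?_⟩) (inf_le_inf_left T (h.succ_le i))
      obtain ⟨e, he⟩ := hmk g hg.2
      obtain ⟨m, hm, hgm⟩ := isOfFinOrder_iff_pow_eq_one.1 ((hT g).1 hg.1)
      have h1 : y i ^ (e * m) ∈ B (i + 1) := by
        rw [← QuotientGroup.eq_one_iff, QuotientGroup.mk_zpow, zpow_mul, ← he, zpow_natCast,
          ← QuotientGroup.mk_pow, hgm, QuotientGroup.mk_one]
      have h2 : e = 0 := by
        by_contra h2
        exact ho ⟨(e * m).natAbs, Int.natAbs_pos.2 (mul_ne_zero h2 (by omega)),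
          (Subgroup.natAbs_pow_mem_iff _).2 h1⟩
      rw [h2, zpow_zero] at he
      exact (QuotientGroup.eq_one_iff g).1 he
    rw [heq]
    exact ⟨hfin, Nat.le_mul_of_pos_left _ hM⟩

theorem finite_torsion (h : IsCyclicCentralSeries B y) {n : ℕ} (hn : B n = ⊥) (h₀ : B 0 = ⊤)
    {T : Subgroup G} (hT : IsTorsionSubgroup T) {M : ℕ} (hM : 0 < M)
    (hy : ∀ i < n, (∃ e : ℕ, 0 < e ∧ y i ^ e ∈ B (i + 1)) →
      ∃ e : ℕ, 0 < e ∧ e ≤ M ∧ y i ^ e ∈ B (i + 1)) :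
    Finite T ∧ Nat.card T ≤ M ^ n := by
  have key : ∀ j ≤ n, Finite ↥(T ⊓ B (n - j)) ∧ Nat.card ↥(T ⊓ B (n - j)) ≤ M ^ j := by
    intro j
    induction j with
    | zero =>
      intro _
      rw [Nat.sub_zero, hn, inf_bot_eq]
      exact ⟨inferInstance, by simp⟩
    | succ j ih =>
      intro hj
      have h1 : n - j = n - (j + 1) + 1 := by omega
      obtain ⟨h2, h3⟩ := ih (by omega)
      rw [h1] at h2 h3
      obtain ⟨h4, h5⟩ := h.finite_torsion_inf_step hT hM (hy (n - (j + 1)) (by omega)) h2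
      refine ⟨h4, h5.trans ?_⟩
      rw [pow_succ']
      exact Nat.mul_le_mul_left M h3
  have := key n le_rfl
  rwa [Nat.sub_self, h₀, inf_top_eq] at this

theorem map {N : Type*} [Group N] {A : ℕ → Subgroup N} {x : ℕ → N}
    (h : IsCyclicCentralSeries A x) {π : N →* G} (hπ : Function.Surjective π) :
    IsCyclicCentralSeries (fun i => (A i).map π) (fun i => π (x i)) where
  succ_le i := Subgroup.map_mono (h.succ_le i)
  mem i := Subgroup.mem_map_of_mem π (h.mem i)
  commutator_mem i := by
    rintro _ ⟨g, hg, rfl⟩ k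
    obtain ⟨k, rfl⟩ := hπ k
    rw [← map_commutatorElement]
    exact Subgroup.mem_map_of_mem π (h.commutator_mem i g hg k)
  exists_zpow i := by
    rintro _ ⟨g, hg, rfl⟩
    obtain ⟨e, he⟩ := h.exists_zpow i g hg
    refine ⟨e, ?_⟩
    rw [← map_zpow, ← map_mul]
    exact Subgroup.mem_map_of_mem π he

end IsCyclicCentralSeries

end Torsion

/-! ### Existence of cyclic central series in finitely generated nilpotent groups -/

/-- `B` is the first term of a cyclic central series that reaches the trivial subgroup. -/
def HasCyclicCentralSeries {N : Type*} [Group N] (B : Subgroup N) : Prop :=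
  ∃ (A : ℕ → Subgroup N) (x : ℕ → N) (n : ℕ), IsCyclicCentralSeries A x ∧ A n = ⊥ ∧ A 0 = B

namespace HasCyclicCentralSeries

variable {N : Type*} [Group N] {B : Subgroup N}

theorem bot : HasCyclicCentralSeries (⊥ : Subgroup N) :=
  ⟨fun _ => ⊥, fun _ => 1, 0, ⟨fun _ => le_rfl, fun _ => one_mem _, by simp, by simp⟩, rfl, rfl⟩

theorem sup_zpowers (h : HasCyclicCentralSeries B) {z : N} (hz : ∀ g, ⁅z, g⁆ ∈ B) :
    HasCyclicCentralSeries (B ⊔ Subgroup.zpowers z) := by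
  obtain ⟨A, x, n, hA, hn, rfl⟩ := h
  have hB := hA.normal 0
  refine ⟨fun i => Nat.casesOn i (A 0 ⊔ Subgroup.zpowers z) A, fun i => Nat.casesOn i z x, n + 1,
    ⟨?_, ?_, ?_, ?_⟩, hn, rfl⟩
  · rintro (_ | i)
    · exact le_sup_left
    · exact hA.succ_le i
  · rintro (_ | i)
    · exact Subgroup.mem_sup_right (Subgroup.mem_zpowers z)
    · exact hA.mem i
  · rintro (_ | i)
    · have hle : A 0 ⊔ Subgroup.zpowers z ≤
          (Subgroup.center (N ⧸ A 0)).comap (QuotientGroup.mk' (A 0)) := by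
        rw [sup_le_iff, Subgroup.zpowers_le]
        refine ⟨fun g hg => ?_, QuotientGroup.mk_mem_center_iff.2 hz⟩
        rw [Subgroup.mem_comap, QuotientGroup.mk'_apply, (QuotientGroup.eq_one_iff g).2 hg]
        exact one_mem _
      exact fun g hg => QuotientGroup.mk_mem_center_iff.1 (hle hg)
    · exact hA.commutator_mem i
  · rintro (_ | i)
    · intro g hg
      obtain ⟨b, hb, w, hw, rfl⟩ := Subgroup.mem_sup_of_normal_left.1 hg
      obtain ⟨e, rfl⟩ := Subgroup.mem_zpowers_iff.1 hw
      refine ⟨e, ?_⟩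
      have := hB.conj_mem b hb (z ^ (-e))
      rwa [zpow_neg, inv_inv, ← zpow_neg, mul_assoc] at this
    · exact hA.exists_zpow i

theorem sup_closure (h : HasCyclicCentralSeries B) {Y : Set N} (hY : Y.Finite)
    (hYB : ∀ y ∈ Y, ∀ g, ⁅y, g⁆ ∈ B) : HasCyclicCentralSeries (B ⊔ Subgroup.closure Y) := by
  induction Y, hY using Set.Finite.induction_on with
  | empty => simpa using h
  | @insert z Y _ _ ih =>
    have h1 := (ih fun y hy => hYB y (Set.mem_insert_of_mem z hy)).sup_zpowers (z := z)
      fun g => Subgroup.mem_sup_left (hYB z (Set.mem_insert z Y) g)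
    have h2 : B ⊔ Subgroup.closure Y ⊔ Subgroup.zpowers z = B ⊔ Subgroup.closure (insert z Y) := by
      rw [Set.insert_eq, Subgroup.closure_union, ← Subgroup.zpowers_eq_closure, sup_assoc,
        sup_comm (Subgroup.closure Y)]
    rwa [h2] at h1

end HasCyclicCentralSeries

section LowerCentralSeries

variable {N : Type*} [Group N]

theorem exists_finite_lowerCentralSeries_eq {V : Set N} (hV : V.Finite)
    (hgen : Subgroup.closure V = ⊤) (i : ℕ) : ∃ Y : Set N, Y.Finite ∧
      (⊤ : Subgroup N).lowerCentralSeries i =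
        (⊤ : Subgroup N).lowerCentralSeries (i + 1) ⊔ Subgroup.closure Y := by
  induction i with
  | zero => exact ⟨V, hV, by simp [hgen]⟩
  | succ i ih =>
    obtain ⟨Y, hY, hYL⟩ := ih
    set L := (⊤ : Subgroup N).lowerCentralSeries with hL
    have hcomm : ∀ j, ∀ g ∈ L j, ∀ n, ⁅g, n⁆ ∈ L (j + 1) := fun j g hg n =>
      Subgroup.commutator_mem_commutator hg (Subgroup.mem_top n)
    have hanti : ∀ j, L (j + 1) ≤ L j := fun j =>
      Subgroup.lowerCentralSeries_antitone _ (Nat.le_succ j)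
    have hYL' : ∀ y ∈ Y, y ∈ L i := fun y hy => by
      rw [hYL]
      exact Subgroup.mem_sup_right (Subgroup.subset_closure hy)
    let Z : Set N := Set.image2 (fun y v => ⁅y, v⁆) Y V
    -- Modulo `C` each `y` in `Y` commutes with the generators `V`, hence is central. So `L i` is
    -- central modulo `C`, which forces `L (i + 1) ≤ C`.
    let C := L (i + 2) ⊔ Subgroup.closure Z
    have hCL : C ≤ L (i + 1) := by
      refine sup_le (hanti (i + 1)) ((Subgroup.closure_le _).2 ?_)
      rintro _ ⟨y, hy, v, _, rfl⟩
      exact hcomm i y (hYL' y hy) v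
    have hCn : C.Normal := by
      refine ⟨fun g hg n => ?_⟩
      have h1 : n * g * n⁻¹ = (⁅g, n⁆)⁻¹ * g := by rw [commutatorElement_def]; group
      rw [h1]
      exact mul_mem (inv_mem (Subgroup.mem_sup_left (hcomm (i + 1) g (hCL hg) n))) hg
    refine ⟨Z, hY.image2 _ hV, le_antisymm ?_ hCL⟩
    have hle : L i ≤ (Subgroup.center (N ⧸ C)).comap (QuotientGroup.mk' C) := by
      rw [hYL]
      refine sup_le (fun g hg => ?_) ((Subgroup.closure_le _).2 fun y hy => ?_)
      · exact QuotientGroup.mk_mem_center_iff.2 fun n =>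
          Subgroup.mem_sup_left (hcomm (i + 1) g hg n)
      · exact QuotientGroup.mk_mem_center_of_generators hgen fun v hv =>
          Subgroup.mem_sup_right (Subgroup.subset_closure ⟨y, hy, v, hv, rfl⟩)
    exact Subgroup.commutator_le.2 fun g hg n _ => QuotientGroup.mk_mem_center_iff.1 (hle hg) n

theorem hasCyclicCentralSeries_top {V : Set N} (hV : V.Finite) (hgen : Subgroup.closure V = ⊤)
    {c : ℕ} (hc : (⊤ : Subgroup N).lowerCentralSeries c = ⊥) :
    HasCyclicCentralSeries (⊤ : Subgroup N) := by
  have key : ∀ j ≤ c, HasCyclicCentralSeries ((⊤ : Subgroup N).lowerCentralSeries j) := by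
    intro j hj
    induction hj using Nat.decreasingInduction with
    | self => exact hc ▸ HasCyclicCentralSeries.bot
    | of_succ j _ ih =>
      obtain ⟨Y, hY, hYL⟩ := exists_finite_lowerCentralSeries_eq hV hgen j
      rw [hYL]
      refine ih.sup_closure hY fun y hy g => Subgroup.commutator_mem_commutator ?_
        (Subgroup.mem_top g)
      rw [hYL]
      exact Subgroup.mem_sup_right (Subgroup.subset_closure hy)
  exact key 0 (Nat.zero_le c)

end LowerCentralSeries

/-- In a quotient of a fixed finitely generated nilpotent group by the normal closure of a set of
elements of length at most `l`, the order of the torsion subgroup is polynomial in `l`. -/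
theorem exists_polynomial_card_torsion.{u} {N : Type*} [Group N] {V : Set N} (hV : V.Finite)
    (hV₁ : 1 ∈ V) (hVinv : V⁻¹ = V) (hgen : Subgroup.closure V = ⊤) {c : ℕ}
    (hc : (⊤ : Subgroup N).lowerCentralSeries c = ⊥) :
    ∃ f : Polynomial ℕ, ∀ (G : Type u) [Group G] [Group.IsNilpotent G] (π : N →* G),
      Function.Surjective π → ∀ (l : ℕ) (S : Set N), S ⊆ V ^ l →
      π.ker = Subgroup.normalClosure S →
      ∃ T : Subgroup G, IsTorsionSubgroup T ∧ Finite T ∧ Nat.card T ≤ f.eval l := by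
  obtain ⟨A, x, n, h, hn, h₀⟩ := hasCyclicCentralSeries_top hV hgen hc
  obtain ⟨a, ha⟩ : ∃ a, V ⊆ tailLetters x 0 ^ a := by
    have hex : ∀ v : N, ∃ m, v ∈ tailLetters x 0 ^ m := fun v =>
      h.exists_mem_tailLetters_pow hn 0 v (h₀ ▸ Subgroup.mem_top v)
    choose m hm using hex
    obtain ⟨a, ha⟩ := (hV.image m).bddAbove
    exact ⟨a, fun v hv => Set.pow_subset_pow_right (one_mem_tailLetters x 0)
      (ha (Set.mem_image_of_mem m hv)) (hm v)⟩
  choose P hP using fun i => h.exists_polynomial_pow_mem hn h₀ ha hV₁ hVinv hgen i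
  -- The sum bounds all `n` factor orders at once; the added `1` keeps the bound positive.
  refine ⟨(∑ i ∈ Finset.range n, P i + 1) ^ n, ?_⟩
  intro G _ _ π hπ l S hS hker
  obtain ⟨T, hT⟩ := exists_isTorsionSubgroup (G := G)
  refine ⟨T, hT, ?_⟩
  rw [Polynomial.eval_pow, Polynomial.eval_add, Polynomial.eval_one, Polynomial.eval_finsetSum]
  have hmem : ∀ (i e : ℕ), π (x i) ^ e ∈ (A (i + 1)).map π ↔
      x i ^ e ∈ A (i + 1) ⊔ Subgroup.normalClosure S := by
    intro i e
    rw [← hker, ← Subgroup.comap_map_eq, Subgroup.mem_comap, map_pow]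
  refine (h.map hπ).finite_torsion (by simp [hn]) ?_ hT (Nat.succ_pos _) fun i hi => ?_
  · simp only [h₀]
    exact Subgroup.map_top_of_surjective π hπ
  · simp only [hmem]
    intro he
    obtain ⟨e, he₀, heP, hxe⟩ := hP i l S hS he
    have h1 : (P i).eval l ≤ ∑ i ∈ Finset.range n, (P i).eval l :=
      Finset.single_le_sum (f := fun i => (P i).eval l) (fun _ _ => Nat.zero_le _)
        (Finset.mem_range.2 hi)
    exact ⟨e, he₀, by omega, hxe⟩

/-! ### Reduction to the free nilpotent group -/

section FreeNilpotent

variable (k c : ℕ)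

/-- The free nilpotent group of class `c` on `k` generators. -/
abbrev FreeNilpotent : Type :=
  FreeGroup (Fin k) ⧸ (⊤ : Subgroup (FreeGroup (Fin k))).lowerCentralSeries c

/-- The standard generators of the free nilpotent group. -/
def freeNilpotentOf (i : Fin k) : FreeNilpotent k c := QuotientGroup.mk (FreeGroup.of i)

/-- The standard generators of the free nilpotent group and their inverses, together with `1`. -/
def freeNilpotentLetters : Set (FreeNilpotent k c) :=
  insert 1 (Set.range (freeNilpotentOf k c) ∪ (Set.range (freeNilpotentOf k c))⁻¹)

theorem closure_freeNilpotentLetters : Subgroup.closure (freeNilpotentLetters k c) = ⊤ := by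
  have h1 : (Subgroup.closure (Set.range (FreeGroup.of : Fin k → _))).map
      (QuotientGroup.mk' ((⊤ : Subgroup (FreeGroup (Fin k))).lowerCentralSeries c)) = ⊤ := by
    rw [FreeGroup.closure_range_of]
    exact Subgroup.map_top_of_surjective _ (QuotientGroup.mk'_surjective _)
  rw [MonoidHom.map_closure, ← Set.range_comp] at h1
  rw [eq_top_iff, ← h1]
  exact Subgroup.closure_mono fun v hv => Or.inr (Or.inl hv)

theorem lowerCentralSeries_freeNilpotent :
    (⊤ : Subgroup (FreeNilpotent k c)).lowerCentralSeries c = ⊥ := by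
  have h := Subgroup.map_lowerCentralSeries (⊤ : Subgroup (FreeGroup (Fin k)))
    (QuotientGroup.mk' ((⊤ : Subgroup (FreeGroup (Fin k))).lowerCentralSeries c)) c
  rw [Subgroup.map_top_of_surjective _ (QuotientGroup.mk'_surjective _)] at h
  rw [← h, Subgroup.map_eq_bot_iff, QuotientGroup.ker_mk']

end FreeNilpotent

theorem exists_polynomial_card_torsion_presented.{u} (k c : ℕ) :
    ∃ f : Polynomial ℕ, ∀ (X : Type u) [Fintype X] (R : Finset (GroupWord X)),
      Fintype.card X = k →
      Group.IsNilpotent (FinPresented X R) →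
      Group.nilpotencyClass (FinPresented X R) ≤ c →
      ∃ T : Subgroup (FinPresented X R),
        IsTorsionSubgroup T ∧ Finite T ∧ Nat.card T ≤ f.eval (relatorLength R) := by
  have hV₁ : (1 : FreeNilpotent k c) ∈ freeNilpotentLetters k c := Set.mem_insert _ _
  obtain ⟨f, hf⟩ := exists_polynomial_card_torsion.{u} (V := freeNilpotentLetters k c)
    (((Set.finite_range _).union (Set.finite_range _).inv).insert 1) hV₁
    (by rw [freeNilpotentLetters, Set.inv_insert, Set.union_inv, inv_inv, inv_one, Set.union_comm])
    (closure_freeNilpotentLetters k c) (lowerCentralSeries_freeNilpotent k c)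
  refine ⟨f, fun X _ R hX hnil hclass => ?_⟩
  let E : FreeGroup X ≃* FreeGroup (Fin k) :=
    FreeGroup.freeGroupCongr (Fintype.equivFinOfCardEq hX)
  let q := PresentedGroup.mk
    ((fun w : GroupWord X => (FreeGroup.mk w : FreeGroup X)) '' (R : Set (GroupWord X)))
  have hkill : (⊤ : Subgroup (FreeGroup (Fin k))).lowerCentralSeries c ≤
      (q.comp E.symm.toMonoidHom).ker := by
    rw [← Subgroup.map_eq_bot_iff, Subgroup.map_lowerCentralSeries, eq_bot_iff,
      ← Subgroup.lowerCentralSeries_eq_bot_iff_nilpotencyClass_le.2 hclass]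
    exact Subgroup.lowerCentralSeries_mono c le_top
  let π : FreeNilpotent k c →* FinPresented X R := QuotientGroup.lift _ _ hkill
  let θ : FreeGroup X →* FreeNilpotent k c := (QuotientGroup.mk' _).comp E.toMonoidHom
  have hθ : Function.Surjective θ := (QuotientGroup.mk'_surjective _).comp E.surjective
  have hπθ : π.comp θ = q := by
    ext u
    simp [π, θ]
  have hπ : Function.Surjective π := by
    intro g
    obtain ⟨u, rfl⟩ := PresentedGroup.mk_surjective _ g
    exact ⟨θ u, DFunLike.congr_fun hπθ u⟩
  have hqker : q.ker = Subgroup.normalClosure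
      ((fun w : GroupWord X => (FreeGroup.mk w : FreeGroup X)) '' (R : Set (GroupWord X))) := by
    ext u
    exact PresentedGroup.mk_eq_one_iff
  have hlen : ∀ w : GroupWord X, θ (FreeGroup.mk w) ∈ freeNilpotentLetters k c ^ w.length := by
    intro w
    induction w with
    | nil => simp [← FreeGroup.one_eq_mk]
    | cons p w ih =>
      have h1 : (FreeGroup.mk (p :: w) : FreeGroup X) = FreeGroup.mk [p] * FreeGroup.mk w := by
        rw [FreeGroup.mul_mk]; rfl
      rw [h1, map_mul, List.length_cons, pow_succ']
      refine Set.mul_mem_mul ?_ ih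
      obtain ⟨u, b⟩ := p
      have h2 : θ (FreeGroup.of u) =
          freeNilpotentOf k c (Fintype.equivFinOfCardEq hX u) := by
        simp [θ, E, freeNilpotentOf]
      cases b with
      | true => exact Or.inr (Or.inl ⟨_, h2.symm⟩)
      | false =>
        have h3 : (FreeGroup.mk [(u, false)] : FreeGroup X) = (FreeGroup.of u)⁻¹ := rfl
        rw [h3, map_inv, h2]
        exact Or.inr (Or.inr ⟨_, (inv_inv _).symm⟩)
  refine hf (FinPresented X R) π hπ (relatorLength R)
    (θ '' ((fun w : GroupWord X => (FreeGroup.mk w : FreeGroup X)) '' (R : Set (GroupWord X)))) ?_ ?_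
  -- Each relator is no longer than the total length, and the balls are nested because `1` is a
  -- letter.
  · rintro _ ⟨_, ⟨w, hw, rfl⟩, rfl⟩
    exact Set.pow_subset_pow_right hV₁
      (Finset.single_le_sum (f := List.length) (fun _ _ => Nat.zero_le _) hw) (hlen w)
  · rw [← Subgroup.map_normalClosure _ θ hθ, ← hqker, ← hπθ, ← MonoidHom.comap_ker,
      Subgroup.map_comap_eq_self_of_surjective hθ]

theorem mainTheorem6 (c r : ℕ) :
    ∃ f : Polynomial ℕ, ∀ (X : Type*) [Fintype X] (R : Finset (GroupWord X)),
      Fintype.card X ≤ r →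
      Group.IsNilpotent (FinPresented X R) →
      Group.nilpotencyClass (FinPresented X R) ≤ c →
      ∃ T : Subgroup (FinPresented X R),
        IsTorsionSubgroup T ∧ Finite T ∧ Nat.card T ≤ f.eval (relatorLength R) := by
  choose f hf using fun k => exists_polynomial_card_torsion_presented k c
  -- Summing over all ranks `k ≤ r` dominates the polynomial of each single rank.
  refine ⟨∑ k ∈ Finset.range (r + 1), f k, fun X _ R hX hnil hclass => ?_⟩
  obtain ⟨T, hT, hfin, hcard⟩ := hf (Fintype.card X) X R rfl hnil hclass
  refine ⟨T, hT, hfin, hcard.trans ?_⟩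
  rw [Polynomial.eval_finsetSum]
  exact Finset.single_le_sum (f := fun k => (f k).eval (relatorLength R))
    (fun _ _ => Nat.zero_le _) (Finset.mem_range.2 (Nat.lt_succ_of_le hX))
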